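/- Fix an alphabet $\mathcal A$. A *trace* of length $\lambda$ is a sequence $\mathbf T=(T_i)_{0\le i<\lambda}$ of subsets of $\mathcal A$; put $\mathbf H\le\mathbf T$ if $H_i\subseteq T_i$ for all $i$. Temporal formulas are interpreted in here-and-there traces $\langle\mathbf H,\mathbf T\rangle$ with $\mathbf H\le\mathbf T$ by the satisfaction relation of Temporal Here-and-There logic: atoms are evaluated in $\mathbf H$, temporal operators are read as in LTL over $0,\dots,\lambda-1$, and an implication has to hold (materially) both for $\langle\mathbf H,\mathbf T\rangle$ and for $\langle\mathbf T,\mathbf T\rangle$. A trace $\mathbf T$ is a *temporal stable model* of a set $\Gamma$ of formulas if $\langle\mathbf T,\mathbf T\rangle$ satisfies $\Gamma$ at time point $0$ and no $\langle\mathbf H,\mathbf T\rangle$ with $\mathbf H<\mathbf T$ does. A *present-centered temporal program* $P$ over $\mathcal A$ is a (possibly infinite) set of initial rules $B\to A$, dynamic rules $\widehat{\circ}\,\square(B\to A)$ and final rules $\square(\mathsf F\to(B\to A))$, where $\widehat\circ$ is weak next, $\square$ is "always afterward", $\mathsf F$ holds exactly at the last time point, $B=b_1\wedge\dots\wedge b_n$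 ($n\ge0$), $A=a_1\vee\dots\vee a_m$ ($m\ge0$), all $a_j$ are regular literals ($a$ or $\neg a$ with $a\in\mathcal A$), and the $b_i$ are regular literals or, in dynamic rules only, also literals $\bullet a$, $\neg\bullet a$ ($\bullet$ is "previous"). (So $P$ contains no fulfillment rules $\square(\square p\to q)$ or $\square(p\to\Diamond q)$.) Let $\mathcal A_k=\{a_k\mid a\in\mathcal A\}$ be time-stamped copies of $\mathcal A$, and let $q_1,q_2,\dots$ be further new atoms. Translate literals by $\tau_k(a)=a_k$, $\tau_k(\neg a)=\neg a_k$, $\tau_k(\bullet a)=a_{k-1}$, $\tau_k(\neg\bullet a)=\neg a_{k-1}$. For an initial or dynamic rule $r$ let $\tau^*_k(r)$ be the rule $\tau_k(a_1)\vee\dots\vee\tau_k(a_m)\leftarrow\tau_k(b_1)\wedge\dots\wedge\tau_k(b_n)$; for a final rule, let $\tau^*_k(r)$ be this rule with the additional body literal $\neg q_{k+1}$. Let $$P_0=\{\tau^*_0(r)\mid r\in P\text{ initial or final}\},\qquad P_k=\{\tau^*_k(r)\mid r\in P\text{ dynamic or final}\}\cup\{q_k\leftarrow\}\quad(k>0).$$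 The *point-wise modules* (program, input atoms, output atoms) are $$\mathbb P_0=(P_0,\{q_1\},\mathcal A_0),\qquad \mathbb P_k=(P_k,\ \mathcal A_{k-1}\cup\{q_{k+1}\},\ \mathcal A_k\cup\{q_k\})\quad(k>0).$$ Modules $(Q_1,I_1,O_1)$ and $(Q_2,I_2,O_2)$ are *compositional* if $O_1\cap O_2=\emptyset$ and every strongly connected component of the positive dependency graph of $Q_1\cup Q_2$ is disjoint from $O_1$ or from $O_2$; their *join* is then $(Q_1\cup Q_2,(I_1\setminus O_2)\cup(I_2\setminus O_1),O_1\cup O_2)$. A set of atoms is a *stable model* of a module $(Q,I,O)$ if it is a stable model of the logic program $Q$, i.e. a minimal model of the reduct of $Q$ relative to it (negated atoms in heads and bodies being evaluated in the candidate set). **Theorem.** Let $P$ be a present-centered temporal program over $\mathcal A$, let $\lambda\ge1$ be a natural number, let $\mathbf T=(T_i)_{0\le i<\lambda}$ be a trace of finite length $\lambda$ over $\mathcal A$, and let $X\subseteq\bigcup_{0\le i<\lambda}\mathcal A_i$ be such that $a\in T_i$ iff $a_i\in X$ for all $a\in\mathcal A$ and $0\le i<\lambda$. Then the join $\mathbb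 P_0\sqcup\dots\sqcup\mathbb P_{\lambda-1}$ is defined (for each $0<k<\lambda$, the modules $\mathbb P_0\sqcup\dots\sqcup\mathbb P_{k-1}$ and $\mathbb P_k$ are compositional), and $\mathbf T$ is a temporal stable model of $P$ if and only if $X\cup\{q_i\mid 1\le i<\lambda\}$ is a stable model of $\mathbb P_0\sqcup\dots\sqcup\mathbb P_{\lambda-1}$. -/

import Mathlib

namespace TEL

universe u v

/-! ### Temporal formulas and their satisfaction in here-and-there traces -/

/-- Temporal formulas over the alphabet `α`, with past and future connectives. -/
inductive Formula (α : Type u) : Type u where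
  | atom : α → Formula α
  | bot : Formula α
  | imp : Formula α → Formula α → Formula α
  | and : Formula α → Formula α → Formula α
  | or : Formula α → Formula α → Formula α
  | previous : Formula α → Formula α
  | since : Formula α → Formula α → Formula α
  | trigger : Formula α → Formula α → Formula α
  | next : Formula α → Formula α
  | until : Formula α → Formula α → Formula α
  | release : Formula α → Formula α → Formula α
  | while : Formula α → Formula α → Formula α

namespace Formula

variable {α : Type u}

def neg (φ : Formula α) : Formula α := imp φ bot

def top : Formula α := neg bot

/-- `□ φ`, always afterward. -/
def always (φ : Formula α) : Formula α := release bot φ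

/-- `◇ φ`, eventually afterward. -/
def eventually (φ : Formula α) : Formula α := Formula.until top φ

/-- The formula that holds exactly at the last time point. -/
def final : Formula α := neg (next top)

/-- Weak next. -/
def weakNext (φ : Formula α) : Formula α := or (next φ) final

/-- Finite conjunction; the empty one is `⊤`. -/
def conj : List (Formula α) → Formula α
  | [] => top
  | φ :: l => and φ (conj l)

/-- Finite disjunction; the empty one is `⊥`. -/
def disj : List (Formula α) → Formula α
  | [] => bot
  | φ :: l => or φ (disj l)

end Formula

/-- A trace of finite length `n` over `α`; traces are ordered pointwise by inclusion. -/
abbrev Trace (α : Type u) (n : ℕ) : Type u := Fin n → Set α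

/-- A here-and-there trace of length `n`: a pair of traces `H ≤ T`. -/
structure HTTrace (α : Type u) (n : ℕ) : Type u where
  here : Trace α n
  there : Trace α n
  le : here ≤ there

/-- The total here-and-there trace `⟨T, T⟩`. -/
def HTTrace.ofTrace {α : Type u} {n : ℕ} (T : Trace α n) : HTTrace α n := ⟨T, T, le_rfl⟩

/-- `Sat φ M k`: the here-and-there trace `M` satisfies `φ` at time point `k`. -/
def Sat {α : Type u} {n : ℕ} : Formula α → HTTrace α n → Fin n → Prop
  | .atom a, M, k => a ∈ M.here k
  | .bot, _, _ => False
  | .imp φ ψ, M, k =>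
      ∀ M' : HTTrace α n, M' = M ∨ M' = HTTrace.ofTrace M.there → (¬ Sat φ M' k ∨ Sat ψ M' k)
  | .and φ ψ, M, k => Sat φ M k ∧ Sat ψ M k
  | .or φ ψ, M, k => Sat φ M k ∨ Sat ψ M k
  | .previous φ, M, k => ∃ j : Fin n, (j : ℕ) + 1 = (k : ℕ) ∧ Sat φ M j
  | .since φ ψ, M, k => ∃ j, j ≤ k ∧ Sat ψ M j ∧ ∀ i, j < i → i ≤ k → Sat φ M i
  | .trigger φ ψ, M, k => ∀ j, j ≤ k → (Sat ψ M j ∨ ∃ i, j < i ∧ i ≤ k ∧ Sat φ M i)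
  | .next φ, M, k => ∃ j : Fin n, (j : ℕ) = (k : ℕ) + 1 ∧ Sat φ M j
  | .until φ ψ, M, k => ∃ j, k ≤ j ∧ Sat ψ M j ∧ ∀ i, k ≤ i → i < j → Sat φ M i
  | .release φ ψ, M, k => ∀ j, k ≤ j → (Sat ψ M j ∨ ∃ i, k ≤ i ∧ i < j ∧ Sat φ M i)
  | .while φ ψ, M, k => ∀ j, k ≤ j →
      ∀ M' : HTTrace α n, M' = M ∨ M' = HTTrace.ofTrace M.there →
        (Sat φ M' j ∨ ∃ i, k ≤ i ∧ i < j ∧ ¬ Sat ψ M' i)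

/-- `M` is a model of the temporal theory `Γ`: it satisfies all of `Γ` at time point `0`. -/
def IsModel {α : Type u} {n : ℕ} [NeZero n] (M : HTTrace α n) (Γ : Set (Formula α)) : Prop :=
  ∀ φ ∈ Γ, Sat φ M 0

/-- `T` is a temporal stable model of `Γ`: `⟨T, T⟩` is a model of `Γ` and no `⟨H, T⟩` with
`H < T` is one. -/
def IsTemporalStableModel {α : Type u} {n : ℕ} [NeZero n] (Γ : Set (Formula α))
    (T : Trace α n) : Prop :=
  IsModel (HTTrace.ofTrace T) Γ ∧ ∀ (H : Trace α n) (h : H < T), ¬ IsModel ⟨H, T, h.le⟩ Γ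

/-! ### Literals, rules, temporal programs -/

/-- Regular literals `a`, `¬ a`. -/
inductive Literal (β : Type v) : Type v where
  | pos : β → Literal β
  | neg : β → Literal β

/-- The atom of a regular literal. -/
def Literal.atom {β : Type v} : Literal β → β
  | .pos a => a
  | .neg a => a

/-- Temporal literals `a`, `¬ a`, `previous a`, `¬ previous a`. -/
inductive TemporalLiteral (α : Type u) : Type u where
  | pos : α → TemporalLiteral α
  | neg : α → TemporalLiteral α
  | prev : α → TemporalLiteral α
  | negPrev : α → TemporalLiteral α

/-- The temporal literals that are regular. -/
def TemporalLiteral.IsRegular {α : Type u} : TemporalLiteral α → Prop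
  | .pos _ => True
  | .neg _ => True
  | .prev _ => False
  | .negPrev _ => False

/-- An implication `b₁ ∧ … ∧ bₙ → a₁ ∨ … ∨ aₘ` between literals of type `L`. -/
structure Rule (L : Type v) : Type v where
  body : List L
  head : List L

def Literal.toFormula {α : Type u} : Literal α → Formula α
  | .pos a => .atom a
  | .neg a => .neg (.atom a)

def TemporalLiteral.toFormula {α : Type u} : TemporalLiteral α → Formula α
  | .pos a => .atom a
  | .neg a => .neg (.atom a)
  | .prev a => .previous (.atom a)
  | .negPrev a => .neg (.previous (.atom a))

/-- The formula `B → A` of a rule, given the formulas of its literals. -/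
def Rule.toFormula {L : Type v} {α : Type u} (f : L → Formula α) (r : Rule L) : Formula α :=
  .imp (.conj (r.body.map f)) (.disj (r.head.map f))

/-- Temporal rules: initial, dynamic and final rules, and the two kinds of fulfillment rules. -/
inductive TemporalRule (α : Type u) : Type u where
  | initial : Rule (Literal α) → TemporalRule α
  | dynamic : Rule (TemporalLiteral α) → TemporalRule α
  | final : Rule (Literal α) → TemporalRule α
  | fulfillAlways : α → α → TemporalRule α
  | fulfillEventually : α → α → TemporalRule α

/-- The temporal formulas denoted by temporal rules. -/
def TemporalRule.toFormula {α : Type u} : TemporalRule α → Formula α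
  | .initial r => r.toFormula Literal.toFormula
  | .dynamic r => .weakNext (.always (r.toFormula TemporalLiteral.toFormula))
  | .final r => .always (.imp .final (r.toFormula Literal.toFormula))
  | .fulfillAlways p q => .always (.imp (.always (.atom p)) (.atom q))
  | .fulfillEventually p q => .always (.imp (.atom p) (.eventually (.atom q)))

/-- Present-centered rules: initial, dynamic and final rules all of whose head literals are
regular (for initial and final rules, all literals are regular by definition). Fulfillment rules
are not implications between literals, hence not present-centered. -/
def TemporalRule.IsPresentCentered {α : Type u} : TemporalRule α → Prop
  | .initial _ => True
  | .dynamic r => ∀ l ∈ r.head, l.IsRegular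
  | .final _ => True
  | .fulfillAlways _ _ => False
  | .fulfillEventually _ _ => False

/-- A temporal logic program is a set of temporal rules. -/
abbrev TemporalProgram (α : Type u) : Type u := Set (TemporalRule α)

def TemporalProgram.IsPresentCentered {α : Type u} (P : TemporalProgram α) : Prop :=
  ∀ r ∈ P, r.IsPresentCentered

/-- The theory of a temporal program. -/
def TemporalProgram.theory {α : Type u} (P : TemporalProgram α) : Set (Formula α) :=
  TemporalRule.toFormula '' P

/-! ### Logic programs and their stable models -/

/-- Logic programs over atoms `β`: sets of rules with regular literals in heads and bodies. -/
abbrev LogicProgram (β : Type v) : Type v := Set (Rule (Literal β))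

/-- The positive rule that is left of `r`: the positive body and the positive head. -/
def Rule.positivePart {β : Type v} (r : Rule (Literal β)) : Set β × Set β :=
  ({b | Literal.pos b ∈ r.body}, {a | Literal.pos a ∈ r.head})

/-- The reduct of `P` relative to `X`. A negative literal `¬ a` is read as true if `a ∉ X` and as
false otherwise: rules with a false negative body literal or a true negative head literal are
deleted, and the other negative literals are deleted from the remaining rules. The elements of the
reduct are pairs (body, head) of sets of atoms. -/
def reduct {β : Type v} (P : LogicProgram β) (X : Set β) : Set (Set β × Set β) :=
  {s | ∃ r ∈ P, (∀ b, Literal.neg b ∈ r.body → b ∉ X) ∧ (∀ a, Literal.neg a ∈ r.head → a ∈ X) ∧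
    s = r.positivePart}

/-- `Y` satisfies every positive rule in `S`: if `Y` contains the body, it meets the head. -/
def SatisfiesPositive {β : Type v} (S : Set (Set β × Set β)) (Y : Set β) : Prop :=
  ∀ s ∈ S, s.1 ⊆ Y → (s.2 ∩ Y).Nonempty

/-- `X` is a stable model of `P`: a minimal model of the reduct of `P` relative to `X`. -/
def IsStableModel {β : Type v} (P : LogicProgram β) (X : Set β) : Prop :=
  SatisfiesPositive (reduct P X) X ∧ ∀ Y : Set β, Y ⊂ X → ¬ SatisfiesPositive (reduct P X) Y

/-! ### Modules -/

/-- The atoms that occur in rule heads of `P`. -/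
def headAtoms {β : Type v} (P : LogicProgram β) : Set β :=
  {a | ∃ r ∈ P, ∃ l ∈ r.head, l.atom = a}

/-- The atoms that occur in `P`. -/
def programAtoms {β : Type v} (P : LogicProgram β) : Set β :=
  {a | ∃ r ∈ P, ∃ l, (l ∈ r.head ∨ l ∈ r.body) ∧ l.atom = a}

/-- A module `(P, I, O)`. -/
structure ProgramModule (β : Type v) : Type v where
  program : LogicProgram β
  input : Set β
  output : Set β
  disjoint : input ∩ output = ∅
  atoms_subset : programAtoms program ⊆ input ∪ output
  head_subset : headAtoms program ⊆ output

/-- `X` is a stable model of a module if it is a stable model of its program. -/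
def ProgramModule.IsStableModel {β : Type v} (M : ProgramModule β) (X : Set β) : Prop :=
  TEL.IsStableModel M.program X

/-- Edges of the positive dependency graph: from the atoms in the head of a rule to the atoms in
its positive body. -/
def PosDep {β : Type v} (P : LogicProgram β) (a b : β) : Prop :=
  ∃ r ∈ P, Literal.pos a ∈ r.head ∧ Literal.pos b ∈ r.body

/-- `C` is a strongly connected component of the positive dependency graph of `P`: the class of
some atom under mutual reachability. -/
def IsSCC {β : Type v} (P : LogicProgram β) (C : Set β) : Prop :=
  ∃ a, C = {b | Relation.ReflTransGen (PosDep P) a b ∧ Relation.ReflTransGen (PosDep P) b a}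

/-- Two modules are compositional. -/
def ProgramModule.Compositional {β : Type v} (M₁ M₂ : ProgramModule β) : Prop :=
  M₁.output ∩ M₂.output = ∅ ∧
    ∀ C, IsSCC (M₁.program ∪ M₂.program) C → M₁.output ∩ C = ∅ ∨ M₂.output ∩ C = ∅

/-- The join of two modules, meant for compositional ones. -/
def ProgramModule.join {β : Type v} (M₁ M₂ : ProgramModule β) : ProgramModule β where
  program := M₁.program ∪ M₂.program
  input := (M₁.input \ M₂.output) ∪ (M₂.input \ M₁.output)
  output := M₁.output ∪ M₂.output
  disjoint := by
    have h₁ := M₁.disjoint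
    have h₂ := M₂.disjoint
    rw [Set.eq_empty_iff_forall_notMem] at h₁ h₂ ⊢
    intro x
    have h₁ := h₁ x
    have h₂ := h₂ x
    simp only [Set.mem_inter_iff, Set.mem_union, Set.mem_sdiff] at h₁ h₂ ⊢
    tauto
  atoms_subset := by
    rintro x ⟨r, hr, l, hl, rfl⟩
    have h : l.atom ∈ M₁.input ∪ M₁.output ∨ l.atom ∈ M₂.input ∪ M₂.output := by
      rcases hr with hr | hr
      · exact Or.inl (M₁.atoms_subset ⟨r, hr, l, hl, rfl⟩)
      · exact Or.inr (M₂.atoms_subset ⟨r, hr, l, hl, rfl⟩)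
    simp only [Set.mem_union, Set.mem_sdiff] at h ⊢
    tauto
  head_subset := by
    rintro x ⟨r, hr, l, hl, rfl⟩
    rcases hr with hr | hr
    · exact Or.inl (M₁.head_subset ⟨r, hr, l, hl, rfl⟩)
    · exact Or.inr (M₂.head_subset ⟨r, hr, l, hl, rfl⟩)

/-- The empty module `(∅, ∅, ∅)`, the join of no modules. -/
def ProgramModule.empty (β : Type v) : ProgramModule β where
  program := ∅
  input := ∅
  output := ∅
  disjoint := Set.inter_empty _
  atoms_subset := by rintro x ⟨r, hr, -⟩; exact hr.elim
  head_subset := by rintro x ⟨r, hr, -⟩; exact hr.elim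

/-- The iterated join `M 0 ⊔ ⋯ ⊔ M (n - 1)`, formed from the left. -/
def ProgramModule.bigJoin {β : Type v} (M : ℕ → ProgramModule β) : ℕ → ProgramModule β
  | 0 => ProgramModule.empty β
  | n + 1 => (bigJoin M n).join (M n)

/-! ### The point-wise translation -/

/-- Time-stamped atoms: `a` stamped with `k` for `a` in the alphabet, and `q` stamped with `k` for
one additional atom `q`. -/
inductive StampedAtom (α : Type u) : Type u where
  | atom : α → ℕ → StampedAtom α
  | q : ℕ → StampedAtom α

/-- The copy of the alphabet at time point `k`. -/
def alphabetAt (α : Type u) (k : ℕ) : Set (StampedAtom α) :=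
  {x | ∃ a : α, x = .atom a k}

/-- Translation of regular literals at time point `k`. -/
def Literal.tau {α : Type u} (k : ℕ) : Literal α → Literal (StampedAtom α)
  | .pos a => .pos (.atom a k)
  | .neg a => .neg (.atom a k)

/-- Translation of temporal literals at time point `k > 0`. -/
def TemporalLiteral.tau {α : Type u} (k : ℕ) : TemporalLiteral α → Literal (StampedAtom α)
  | .pos a => .pos (.atom a k)
  | .neg a => .neg (.atom a k)
  | .prev a => .pos (.atom a (k - 1))
  | .negPrev a => .neg (.atom a (k - 1))

/-- Translation of an initial rule at time point `k`. -/
def tauInitial {α : Type u} (k : ℕ) (r : Rule (Literal α)) : Rule (Literal (StampedAtom α)) where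
  body := r.body.map (Literal.tau k)
  head := r.head.map (Literal.tau k)

/-- Translation of a dynamic rule at time point `k`. -/
def tauDynamic {α : Type u} (k : ℕ) (r : Rule (TemporalLiteral α)) :
    Rule (Literal (StampedAtom α)) where
  body := r.body.map (TemporalLiteral.tau k)
  head := r.head.map (TemporalLiteral.tau k)

/-- Point-wise translation of a final rule at time point `k`, with the additional body literal
`¬ q` stamped with `k + 1`. -/
def tauFinal {α : Type u} (k : ℕ) (r : Rule (Literal α)) : Rule (Literal (StampedAtom α)) where
  body := r.body.map (Literal.tau k) ++ [Literal.neg (.q (k + 1))]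
  head := r.head.map (Literal.tau k)

/-- The logic program of `P` at time point `k`. -/
def pointwiseProgram {α : Type u} (P : TemporalProgram α) : ℕ → LogicProgram (StampedAtom α)
  | 0 => {s | ∃ r, TemporalRule.initial r ∈ P ∧ s = tauInitial 0 r} ∪
      {s | ∃ r, TemporalRule.final r ∈ P ∧ s = tauFinal 0 r}
  | k + 1 => {s | ∃ r, TemporalRule.dynamic r ∈ P ∧ s = tauDynamic (k + 1) r} ∪
      {s | ∃ r, TemporalRule.final r ∈ P ∧ s = tauFinal (k + 1) r} ∪
      {⟨[], [Literal.pos (.q (k + 1))]⟩}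

def pointwiseInput (α : Type u) : ℕ → Set (StampedAtom α)
  | 0 => {.q 1}
  | k + 1 => alphabetAt α k ∪ {.q (k + 2)}

def pointwiseOutput (α : Type u) : ℕ → Set (StampedAtom α)
  | 0 => alphabetAt α 0
  | k + 1 => alphabetAt α (k + 1) ∪ {.q (k + 1)}

theorem pointwise_disjoint (α : Type u) (k : ℕ) :
    pointwiseInput α k ∩ pointwiseOutput α k = ∅ := by
  rw [Set.eq_empty_iff_forall_notMem]
  rintro x ⟨hI, hO⟩
  cases k with
  | zero =>
    obtain ⟨a, rfl⟩ := hO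
    cases hI
  | succ k =>
    rcases hI with ⟨a, rfl⟩ | hI
    · rcases hO with ⟨b, hb⟩ | hO
      · injection hb with _ h
        omega
      · cases hO
    · cases hI
      rcases hO with ⟨b, hb⟩ | hO
      · cases hb
      · injection hO with h
        omega

theorem Literal.tau_atom_mem {α : Type u} (k : ℕ) (l : Literal α) :
    (l.tau k).atom ∈ alphabetAt α k := by
  cases l <;> exact ⟨_, rfl⟩

theorem alphabetAt_subset_output (α : Type u) (k : ℕ) :
    alphabetAt α k ⊆ pointwiseOutput α k := by
  cases k with
  | zero => exact subset_rfl
  | succ k => exact Set.subset_union_left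

theorem q_mem_input (α : Type u) (k : ℕ) : StampedAtom.q (k + 1) ∈ pointwiseInput α k := by
  cases k with
  | zero => exact rfl
  | succ k => exact Or.inr rfl

theorem pointwise_head_subset {α : Type u} (P : TemporalProgram α) (hP : P.IsPresentCentered)
    (k : ℕ) : headAtoms (pointwiseProgram P k) ⊆ pointwiseOutput α k := by
  rintro x ⟨s, hs, l, hl, rfl⟩
  have key : ∀ r : Rule (Literal α), l ∈ r.head.map (Literal.tau k) →
      l.atom ∈ pointwiseOutput α k := by
    intro r h
    obtain ⟨l', -, rfl⟩ := List.mem_map.1 h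
    exact alphabetAt_subset_output α k (l'.tau_atom_mem k)
  cases k with
  | zero =>
    rcases hs with ⟨r, -, rfl⟩ | ⟨r, -, rfl⟩
    · exact key r hl
    · exact key r hl
  | succ k =>
    rcases hs with (⟨r, hr, rfl⟩ | ⟨r, -, rfl⟩) | hs
    · obtain ⟨l', hl', rfl⟩ := List.mem_map.1 hl
      have hreg : l'.IsRegular := hP _ hr l' hl'
      cases l' with
      | pos a => exact Or.inl ⟨a, rfl⟩
      | neg a => exact Or.inl ⟨a, rfl⟩
      | prev a => exact hreg.elim
      | negPrev a => exact hreg.elim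
    · exact key r hl
    · cases hs
      obtain rfl := List.mem_singleton.1 hl
      exact Or.inr rfl

theorem pointwise_atoms_subset {α : Type u} (P : TemporalProgram α) (hP : P.IsPresentCentered)
    (k : ℕ) :
    programAtoms (pointwiseProgram P k) ⊆ pointwiseInput α k ∪ pointwiseOutput α k := by
  rintro x ⟨s, hs, l, hl, rfl⟩
  rcases hl with hl | hl
  · exact Or.inr (pointwise_head_subset P hP k ⟨s, hs, l, hl, rfl⟩)
  have key : ∀ r : Rule (Literal α), l ∈ r.body.map (Literal.tau k) →
      l.atom ∈ pointwiseInput α k ∪ pointwiseOutput α k := by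
    intro r h
    obtain ⟨l', -, rfl⟩ := List.mem_map.1 h
    exact Or.inr (alphabetAt_subset_output α k (l'.tau_atom_mem k))
  have keyFinal : ∀ r : Rule (Literal α), l ∈ (tauFinal k r).body →
      l.atom ∈ pointwiseInput α k ∪ pointwiseOutput α k := by
    intro r h
    rcases List.mem_append.1 h with h | h
    · exact key r h
    · obtain rfl := List.mem_singleton.1 h
      exact Or.inl (q_mem_input α k)
  cases k with
  | zero =>
    rcases hs with ⟨r, -, rfl⟩ | ⟨r, -, rfl⟩
    · exact key r hl
    · exact keyFinal r hl
  | succ k =>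
    rcases hs with (⟨r, -, rfl⟩ | ⟨r, -, rfl⟩) | hs
    · obtain ⟨l', -, rfl⟩ := List.mem_map.1 hl
      cases l' with
      | pos a => exact Or.inr (Or.inl ⟨a, rfl⟩)
      | neg a => exact Or.inr (Or.inl ⟨a, rfl⟩)
      | prev a => exact Or.inl (Or.inl ⟨a, rfl⟩)
      | negPrev a => exact Or.inl (Or.inl ⟨a, rfl⟩)
    · exact keyFinal r hl
    · cases hs
      exact absurd hl List.not_mem_nil

/-- The module of the present-centered temporal program `P` at time point `k`. -/
def pointwiseModule {α : Type u} (P : TemporalProgram α) (hP : P.IsPresentCentered) (k : ℕ) :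
    ProgramModule (StampedAtom α) where
  program := pointwiseProgram P k
  input := pointwiseInput α k
  output := pointwiseOutput α k
  disjoint := pointwise_disjoint α k
  atoms_subset := pointwise_atoms_subset P hP k
  head_subset := pointwise_head_subset P hP k

end TEL

namespace TEL

universe u v

/-! ### Rules read materially -/

/-! Both notions of stability amount to one condition: rules read materially, with positive literals
evaluated in a smaller set and negated ones in the candidate. For logic programs, deleting a rule in
the reduct only drops a constraint that a negative literal already makes true
(`satisfiesPositive_reduct_iff`). On the temporal side, an implication also has to hold in `⟨T, T⟩`,
but that part does not depend on `H` and is the first half of stability, so it drops out of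
minimality (`isTemporalStableModel_theory_iff`).

The two are linked by `Trace.encode`, an order embedding of traces into sets of stamped atoms. Each
code contains exactly the `q i` with `1 ≤ i < n`, so `¬ q (k + 1)` switches a final rule on at the
last time point only, and rule instances match (`forall_mem_program_holds_iff`). The facts `q i`
force every model of the reduct below a code to be a code (`exists_eq_encode`), so minimality has
the same competitors on both sides. The program of the join is just the union of the programs; no
module theorem is needed.

Compositionality is separate: positive dependencies never increase the time stamp, so strongly
connected components have constant stamp, while the outputs of different modules have different
stamps. -/

/-- The rule `r` holds if its literals are evaluated by `p`. -/
def Rule.Holds {L : Type v} (p : L → Prop) (r : Rule L) : Prop :=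
  (∀ b ∈ r.body, p b) → ∃ a ∈ r.head, p a

/-- The value of a literal with positive literals evaluated in `Y`, negative ones in `X`. -/
def Literal.Holds {β : Type v} (Y X : Set β) : Literal β → Prop
  | .pos a => a ∈ Y
  | .neg a => a ∉ X

theorem satisfiesPositive_reduct_iff {β : Type v} (P : LogicProgram β) (X Y : Set β) :
    SatisfiesPositive (reduct P X) Y ↔ ∀ r ∈ P, r.Holds (Literal.Holds Y X) := by
  constructor
  · intro h r hr hb
    -- A true negated head literal already satisfies the head; without one, the rule survives into
    -- the reduct.
    by_cases hneg : ∃ a, Literal.neg a ∈ r.head ∧ a ∉ X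
    · obtain ⟨a, ha, haX⟩ := hneg
      exact ⟨_, ha, haX⟩
    · push Not at hneg
      obtain ⟨a, ha, haY⟩ := h r.positivePart
        ⟨r, hr, fun b hbr => hb _ hbr, hneg, rfl⟩ (fun b hbr => hb _ hbr)
      exact ⟨_, ha, haY⟩
  · rintro h _ ⟨r, hr, hbody, hhead, rfl⟩ hs
    obtain ⟨l, hl, hlY⟩ := h r hr (by
      intro b hb
      cases b with
      | pos b => exact hs hb
      | neg b => exact hbody b hb)
    cases l with
    | pos a => exact ⟨a, hl, hlY⟩
    | neg a => exact absurd (hhead a hl) hlY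

/-! ### Satisfaction of derived formulas -/

section Sat

variable {α : Type u} {n : ℕ} (M : HTTrace α n) (k : Fin n)

theorem sat_imp (φ ψ : Formula α) :
    Sat (.imp φ ψ) M k ↔ (Sat φ M k → Sat ψ M k) ∧
      (Sat φ (HTTrace.ofTrace M.there) k → Sat ψ (HTTrace.ofTrace M.there) k) := by
  rw [Sat]
  simp only [forall_eq_or_imp, forall_eq, imp_iff_not_or.symm]

theorem sat_top : Sat .top M k := by
  simp [Formula.top, Formula.neg, sat_imp]

theorem sat_conj (l : List (Formula α)) :
    Sat (.conj l) M k ↔ ∀ φ ∈ l, Sat φ M k := by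
  induction l with
  | nil => simp [Formula.conj, sat_top]
  | cons φ l ih => simp [Formula.conj, Sat, ih]

theorem sat_disj (l : List (Formula α)) :
    Sat (.disj l) M k ↔ ∃ φ ∈ l, Sat φ M k := by
  induction l with
  | nil => simp [Formula.disj, Sat]
  | cons φ l ih => simp [Formula.disj, Sat, ih]

theorem sat_always (φ : Formula α) : Sat φ.always M k ↔ ∀ j, k ≤ j → Sat φ M j := by
  simp [Formula.always, Sat]

theorem sat_final : Sat .final M k ↔ (k : ℕ) + 1 = n := by
  have h : (¬ ∃ j : Fin n, (j : ℕ) = (k : ℕ) + 1) ↔ (k : ℕ) + 1 = n := by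
    constructor
    · intro h
      by_contra hne
      exact h ⟨⟨k + 1, by omega⟩, rfl⟩
    · rintro h ⟨j, hj⟩
      omega
  rw [← h]
  simp [Formula.final, Formula.neg, sat_imp, Sat, sat_top]

theorem sat_rule {L : Type v} (f : L → Formula α) (r : Rule L) :
    Sat (r.toFormula f) M k ↔ r.Holds (fun l => Sat (f l) M k) ∧
      r.Holds (fun l => Sat (f l) (HTTrace.ofTrace M.there) k) := by
  simp [Rule.toFormula, Rule.Holds, sat_imp, sat_conj, sat_disj]

/-- The `⟨T, T⟩` part of the implication decides, since `a ∉ T k` entails `a ∉ H k`. This matches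
the evaluation of negated atoms in the candidate set. -/
theorem sat_neg_atom (a : α) : Sat (.neg (.atom a)) M k ↔ a ∉ M.there k := by
  simp only [Formula.neg, sat_imp, Sat, imp_false]
  exact ⟨fun h => h.2, fun h => ⟨fun h' => h (M.le k h'), h⟩⟩

theorem sat_neg_previous_atom (a : α) :
    Sat (.neg (.previous (.atom a))) M k ↔
      ∀ j : Fin n, (j : ℕ) + 1 = (k : ℕ) → a ∉ M.there j := by
  simp only [Formula.neg, sat_imp, Sat, imp_false, not_exists, not_and]
  exact ⟨fun h => h.2, fun h => ⟨fun j hj h' => h j hj (M.le j h'), h⟩⟩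

end Sat

/-- For `n = 1` the disjunct `final` holds and the right side is vacuous; otherwise `next` moves to
time point `1`, the least positive one. -/
theorem sat_weakNext_always_zero {α : Type u} {n : ℕ} [NeZero n] (M : HTTrace α n)
    (φ : Formula α) :
    Sat (.weakNext (.always φ)) M 0 ↔ ∀ k : Fin n, 0 < (k : ℕ) → Sat φ M k := by
  have hn : 0 < n := Nat.pos_of_neZero n
  change (∃ j : Fin n, (j : ℕ) = ((0 : Fin n) : ℕ) + 1 ∧ Sat φ.always M j) ∨ Sat .final M 0 ↔ _
  simp only [sat_always, sat_final, Fin.val_zero, zero_add]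
  constructor
  · rintro (⟨j, hj, h⟩ | h) k hk
    · exact h k (by rw [Fin.le_def]; omega)
    · omega
  · intro h
    by_cases h1 : 1 = n
    · exact Or.inr h1
    · refine Or.inl ⟨⟨1, by omega⟩, rfl, fun k hk => h k ?_⟩
      rw [Fin.le_def] at hk
      exact hk

/-! ### Satisfaction of present-centered rules -/

/-- A present-centered temporal rule read materially in the here-and-there trace `M`. -/
def TemporalRule.Holds {α : Type u} {n : ℕ} [NeZero n] (M : HTTrace α n) :
    TemporalRule α → Prop
  | .initial r => r.Holds (fun l => Sat l.toFormula M 0)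
  | .dynamic r => ∀ k : Fin n, 0 < (k : ℕ) → r.Holds (fun l => Sat l.toFormula M k)
  | .final r => ∀ k : Fin n, (k : ℕ) + 1 = n → r.Holds (fun l => Sat l.toFormula M k)
  | .fulfillAlways _ _ => True
  | .fulfillEventually _ _ => True

theorem sat_temporalRule {α : Type u} {n : ℕ} [NeZero n] (M : HTTrace α n)
    (r : TemporalRule α) (hr : r.IsPresentCentered) :
    Sat r.toFormula M 0 ↔ r.Holds M ∧ r.Holds (HTTrace.ofTrace M.there) := by
  cases r with
  | initial r => exact sat_rule M 0 _ r
  | dynamic r =>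
    simp only [TemporalRule.toFormula, sat_weakNext_always_zero, sat_rule, TemporalRule.Holds]
    exact ⟨fun h => ⟨fun k hk => (h k hk).1, fun k hk => (h k hk).2⟩,
      fun h k hk => ⟨h.1 k hk, h.2 k hk⟩⟩
  | final r =>
    simp only [TemporalRule.toFormula, sat_always, sat_imp, sat_final, sat_rule,
      TemporalRule.Holds]
    exact ⟨fun h => ⟨fun k hk => ((h k (Fin.zero_le _)).1 hk).1,
        fun k hk => ((h k (Fin.zero_le _)).1 hk).2⟩,
      -- Being last does not depend on `H`, so the `⟨T, T⟩` half of the outer implication only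
      -- repeats what the inner one demands there.
      fun h k _ => ⟨fun hk => ⟨h.1 k hk, h.2 k hk⟩, fun hk => ⟨h.2 k hk, h.2 k hk⟩⟩⟩
  | fulfillAlways p q => exact hr.elim
  | fulfillEventually p q => exact hr.elim

theorem isModel_theory_iff {α : Type u} {n : ℕ} [NeZero n] {P : TemporalProgram α}
    (hP : P.IsPresentCentered) (M : HTTrace α n) :
    IsModel M P.theory ↔ (∀ r ∈ P, r.Holds M) ∧ ∀ r ∈ P, r.Holds (HTTrace.ofTrace M.there) := by
  simp only [IsModel, TemporalProgram.theory, Set.forall_mem_image]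
  exact ⟨fun h => ⟨fun r hr => ((sat_temporalRule M r (hP r hr)).1 (h hr)).1,
      fun r hr => ((sat_temporalRule M r (hP r hr)).1 (h hr)).2⟩,
    fun h r hr => (sat_temporalRule M r (hP r hr)).2 ⟨h.1 r hr, h.2 r hr⟩⟩

theorem isTemporalStableModel_theory_iff {α : Type u} {n : ℕ} [NeZero n]
    {P : TemporalProgram α} (hP : P.IsPresentCentered) (T : Trace α n) :
    IsTemporalStableModel P.theory T ↔ (∀ r ∈ P, r.Holds (HTTrace.ofTrace T)) ∧
      ∀ (H : Trace α n) (h : H < T), ¬ ∀ r ∈ P, r.Holds ⟨H, T, h.le⟩ := by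
  simp only [IsTemporalStableModel, isModel_theory_iff hP]
  exact ⟨fun h => ⟨h.1.1, fun H hH h' => h.2 H hH ⟨h', h.1.1⟩⟩,
    fun h => ⟨⟨h.1, h.1⟩, fun H hH h' => h.2 H hH h'.1⟩⟩

/-! ### The iterated join -/

section BigJoin

variable {β : Type v} (M : ℕ → ProgramModule β) (n : ℕ)

theorem ProgramModule.mem_bigJoin_program (r : Rule (Literal β)) :
    r ∈ (bigJoin M n).program ↔ ∃ k < n, r ∈ (M k).program := by
  induction n with
  | zero => simp [bigJoin, empty]
  | succ n ih =>
    change r ∈ (bigJoin M n).program ∨ r ∈ (M n).program ↔ _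
    rw [ih, Nat.exists_lt_succ_right]

theorem ProgramModule.mem_bigJoin_output (x : β) :
    x ∈ (bigJoin M n).output ↔ ∃ k < n, x ∈ (M k).output := by
  induction n with
  | zero => simp [bigJoin, empty]
  | succ n ih =>
    change x ∈ (bigJoin M n).output ∨ x ∈ (M n).output ↔ _
    rw [ih, Nat.exists_lt_succ_right]

end BigJoin

/-! ### Compositionality -/

/-- The time stamp of an atom. -/
def StampedAtom.stamp {α : Type u} : StampedAtom α → ℕ
  | .atom _ k => k
  | .q k => k

theorem stamp_of_mem_pointwiseOutput {α : Type u} {k : ℕ} {x : StampedAtom α}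
    (hx : x ∈ pointwiseOutput α k) : x.stamp = k := by
  cases k with
  | zero =>
    obtain ⟨a, rfl⟩ := hx
    rfl
  | succ k =>
    rcases hx with ⟨a, rfl⟩ | hx
    · rfl
    · cases hx
      rfl

theorem Literal.stamp_tau {α : Type u} (k : ℕ) (l : Literal α) :
    (l.tau k).atom.stamp = k := by
  cases l <;> rfl

theorem TemporalLiteral.stamp_tau_le {α : Type u} (k : ℕ) (l : TemporalLiteral α) :
    (l.tau k).atom.stamp ≤ k := by
  cases l <;> first | exact le_rfl | exact Nat.sub_le k 1

/-- The only atom of module `k` with a later stamp is `q (k + 1)`, and it occurs only under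
negation. -/
theorem stamp_le_of_pos_mem_body {α : Type u} {P : TemporalProgram α} {k : ℕ}
    {r : Rule (Literal (StampedAtom α))} (hr : r ∈ pointwiseProgram P k) {b : StampedAtom α}
    (hb : Literal.pos b ∈ r.body) : b.stamp ≤ k := by
  have key : ∀ r : Rule (Literal α), Literal.pos b ∈ r.body.map (Literal.tau k) →
      b.stamp ≤ k := by
    intro r h
    obtain ⟨l, -, hl⟩ := List.mem_map.1 h
    have := l.stamp_tau k
    rw [hl] at this
    exact this.le
  have keyFinal : ∀ r : Rule (Literal α), Literal.pos b ∈ (tauFinal k r).body →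
      b.stamp ≤ k := by
    intro r h
    rcases List.mem_append.1 h with h | h
    · exact key r h
    · cases List.mem_singleton.1 h
  cases k with
  | zero =>
    rcases hr with ⟨r, -, rfl⟩ | ⟨r, -, rfl⟩
    · exact key r hb
    · exact keyFinal r hb
  | succ k =>
    rcases hr with (⟨r, -, rfl⟩ | ⟨r, -, rfl⟩) | hr
    · obtain ⟨l, -, hl⟩ := List.mem_map.1 hb
      have := l.stamp_tau_le (k + 1)
      rwa [hl] at this
    · exact keyFinal r hb
    · cases hr
      exact absurd hb List.not_mem_nil

theorem compositional_bigJoin_pointwiseModule {α : Type u} (P : TemporalProgram α)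
    (hP : P.IsPresentCentered) (k : ℕ) :
    (ProgramModule.bigJoin (pointwiseModule P hP) k).Compositional (pointwiseModule P hP k) := by
  have hout : ∀ x ∈ (ProgramModule.bigJoin (pointwiseModule P hP) k).output, x.stamp < k := by
    intro x hx
    obtain ⟨j, hj, hx⟩ := (ProgramModule.mem_bigJoin_output _ _ _).1 hx
    rwa [stamp_of_mem_pointwiseOutput hx]
  have hdep : ∀ a b, PosDep ((ProgramModule.bigJoin (pointwiseModule P hP) k).program ∪
      (pointwiseModule P hP k).program) a b → b.stamp ≤ a.stamp := by
    rintro a b ⟨r, hr, ha, hb⟩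
    -- The union is by definition the program of the join of `k + 1` modules, so the edge comes from
    -- a single module `j`, whose head atoms all have stamp `j`.
    obtain ⟨j, -, hr⟩ := (ProgramModule.mem_bigJoin_program (pointwiseModule P hP) (k + 1) r).1 hr
    have h : a.stamp = j :=
      stamp_of_mem_pointwiseOutput (pointwise_head_subset P hP j ⟨r, hr, _, ha, rfl⟩)
    rw [h]
    exact stamp_le_of_pos_mem_body hr hb
  have hreach : ∀ a b, Relation.ReflTransGen
      (PosDep ((ProgramModule.bigJoin (pointwiseModule P hP) k).program ∪
        (pointwiseModule P hP k).program)) a b → b.stamp ≤ a.stamp := by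
    intro a b h
    induction h with
    | refl => exact le_rfl
    | tail _ h ih => exact (hdep _ _ h).trans ih
  constructor
  · rw [Set.eq_empty_iff_forall_notMem]
    rintro x ⟨h₁, h₂⟩
    exact (hout x h₁).ne (stamp_of_mem_pointwiseOutput h₂)
  · rintro C ⟨c, rfl⟩
    -- A component meeting both outputs has a path from some `x` of stamp below `k` through `c` to
    -- some `y` of stamp `k`.
    by_contra! h
    obtain ⟨⟨x, hx, hxc⟩, ⟨y, hy, hyc⟩⟩ := h
    have h₁ := hout x hx
    have h₂ : y.stamp = k := stamp_of_mem_pointwiseOutput hy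
    have h₃ := hreach _ _ hxc.2
    have h₄ := hreach _ _ hyc.1
    omega

/-! ### Traces as sets of stamped atoms -/

/-- The atoms `a` stamped with `i` for `a ∈ T i`, together with all `q` stamped with
`1, …, n - 1`. -/
def Trace.encode {α : Type u} {n : ℕ} (T : Trace α n) : Set (StampedAtom α) :=
  {x | ∃ (i : Fin n) (a : α), a ∈ T i ∧ x = .atom a i} ∪ {x | ∃ i : ℕ, 1 ≤ i ∧ i < n ∧ x = .q i}

section Encode

variable {α : Type u} {n : ℕ} {H T : Trace α n}

theorem Trace.atom_mem_encode (i : Fin n) (a : α) : .atom a (i : ℕ) ∈ T.encode ↔ a ∈ T i := by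
  simp only [encode, Set.mem_union, Set.mem_ofPred_eq, StampedAtom.atom.injEq, reduceCtorEq,
    and_false, exists_false, or_false]
  constructor
  · rintro ⟨j, b, hb, rfl, hij⟩
    rwa [Fin.ext hij]
  · exact fun h => ⟨i, a, h, rfl, rfl⟩

theorem Trace.q_mem_encode (i : ℕ) : .q i ∈ T.encode ↔ 1 ≤ i ∧ i < n := by
  simp [encode]

/-- The `q` part depends only on the length `n`, so codes are compared by their alphabet atoms
alone. -/
theorem Trace.encode_subset_encode : H.encode ⊆ T.encode ↔ H ≤ T := by
  constructor
  · exact fun h i a ha => (atom_mem_encode i a).1 (h ((atom_mem_encode i a).2 ha))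
  · rintro h x (⟨i, a, ha, rfl⟩ | hx)
    · exact Or.inl ⟨i, a, h i ha, rfl⟩
    · exact Or.inr hx

theorem Trace.encode_ssubset_encode : H.encode ⊂ T.encode ↔ H < T := by
  rw [ssubset_iff_subset_not_subset, encode_subset_encode, encode_subset_encode, lt_iff_le_not_ge]

theorem Literal.holds_tau (h : H ≤ T) (k : Fin n) (l : Literal α) :
    (l.tau k).Holds H.encode T.encode ↔ Sat l.toFormula ⟨H, T, h⟩ k := by
  cases l with
  | pos a => exact Trace.atom_mem_encode k a
  | neg a => exact (not_congr (Trace.atom_mem_encode k a)).trans (sat_neg_atom ⟨H, T, h⟩ k a).symm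

theorem TemporalLiteral.holds_tau (h : H ≤ T) (k : Fin n) (hk : 0 < (k : ℕ))
    (l : TemporalLiteral α) :
    (l.tau k).Holds H.encode T.encode ↔ Sat l.toFormula ⟨H, T, h⟩ k := by
  -- Since `0 < k`, the subtraction is not truncated, and `j` is the only possible witness for
  -- `previous`.
  obtain ⟨j, hj⟩ : ∃ j : Fin n, (j : ℕ) = (k : ℕ) - 1 := ⟨⟨k - 1, by omega⟩, rfl⟩
  have hjk : ∀ i : Fin n, (i : ℕ) + 1 = (k : ℕ) ↔ i = j := by
    intro i
    rw [Fin.ext_iff]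
    omega
  cases l with
  | pos a => exact Trace.atom_mem_encode k a
  | neg a => exact (not_congr (Trace.atom_mem_encode k a)).trans (sat_neg_atom ⟨H, T, h⟩ k a).symm
  | prev a =>
    change StampedAtom.atom a ((k : ℕ) - 1) ∈ H.encode ↔ _
    rw [← hj, Trace.atom_mem_encode]
    simp [toFormula, Sat, hjk]
  | negPrev a =>
    change StampedAtom.atom a ((k : ℕ) - 1) ∉ T.encode ↔ _
    rw [← hj, Trace.atom_mem_encode]
    simp [toFormula, sat_neg_previous_atom, hjk]

theorem Rule.holds_map {L : Type*} {L' : Type*} (f : L → L') (p : L' → Prop) (r : Rule L) :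
    Rule.Holds p ⟨r.body.map f, r.head.map f⟩ ↔ r.Holds (fun l => p (f l)) := by
  simp [Rule.Holds]

theorem holds_tauInitial (h : H ≤ T) (k : Fin n) (r : Rule (Literal α)) :
    (tauInitial k r).Holds (Literal.Holds H.encode T.encode) ↔
      r.Holds (fun l => Sat l.toFormula ⟨H, T, h⟩ k) := by
  rw [tauInitial, Rule.holds_map]
  simp only [Literal.holds_tau h]

theorem holds_tauDynamic (h : H ≤ T) (k : Fin n) (hk : 0 < (k : ℕ))
    (r : Rule (TemporalLiteral α)) :
    (tauDynamic k r).Holds (Literal.Holds H.encode T.encode) ↔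
      r.Holds (fun l => Sat l.toFormula ⟨H, T, h⟩ k) := by
  rw [tauDynamic, Rule.holds_map]
  simp only [TemporalLiteral.holds_tau h k hk]

theorem holds_tauFinal (h : H ≤ T) (k : Fin n) (r : Rule (Literal α)) :
    (tauFinal k r).Holds (Literal.Holds H.encode T.encode) ↔
      ((k : ℕ) + 1 = n → r.Holds (fun l => Sat l.toFormula ⟨H, T, h⟩ k)) := by
  have hq : (Literal.neg (.q ((k : ℕ) + 1))).Holds H.encode T.encode ↔ (k : ℕ) + 1 = n := by
    change ¬ StampedAtom.q ((k : ℕ) + 1) ∈ T.encode ↔ _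
    rw [Trace.q_mem_encode]
    -- As `k < n`, the atom `q (k + 1)` is missing from the code only for `k + 1 = n`.
    omega
  rw [← holds_tauInitial h k r]
  simp only [Rule.Holds, tauFinal, tauInitial, List.mem_append, List.mem_singleton, or_imp,
    forall_and, forall_eq, hq]
  tauto

theorem forall_mem_program_holds_iff [NeZero n] (P : TemporalProgram α)
    (hP : P.IsPresentCentered) (h : H ≤ T) :
    (∀ r ∈ (ProgramModule.bigJoin (pointwiseModule P hP) n).program,
      r.Holds (Literal.Holds H.encode T.encode)) ↔ ∀ r ∈ P, r.Holds ⟨H, T, h⟩ := by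
  have hn : 0 < n := Nat.pos_of_neZero n
  simp only [ProgramModule.mem_bigJoin_program]
  constructor
  · intro hs r hr
    cases r with
    | initial r =>
      refine (holds_tauInitial h 0 r).1 (hs _ ⟨0, hn, Or.inl ⟨r, hr, ?_⟩⟩)
      rw [Fin.val_zero]
    | dynamic r =>
      intro k hk
      refine (holds_tauDynamic h k hk r).1 (hs _ ⟨k, k.2, ?_⟩)
      -- Exposes the successor case in the definition of `pointwiseProgram`.
      obtain ⟨j, hj⟩ := Nat.exists_eq_succ_of_ne_zero hk.ne'
      rw [hj]
      exact Or.inl (Or.inl ⟨r, hr, rfl⟩)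
    | final r =>
      intro k hk
      refine (holds_tauFinal h k r).1 (hs _ ⟨k, k.2, ?_⟩) hk
      cases (k : ℕ) with
      | zero => exact Or.inr ⟨r, hr, rfl⟩
      | succ j => exact Or.inl (Or.inr ⟨r, hr, rfl⟩)
    | fulfillAlways p q => trivial
    | fulfillEventually p q => trivial
  · rintro hs s ⟨k, hk, hs'⟩
    have hfinal : ∀ r, TemporalRule.final r ∈ P →
        (tauFinal k r).Holds (Literal.Holds H.encode T.encode) := fun r hr =>
      (holds_tauFinal h ⟨k, hk⟩ r).2 (hs _ hr ⟨k, hk⟩)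
    cases k with
    | zero =>
      rcases hs' with ⟨r, hr, rfl⟩ | ⟨r, hr, rfl⟩
      · exact (holds_tauInitial h ⟨0, hk⟩ r).2 (hs _ hr)
      · exact hfinal r hr
    | succ k =>
      rcases hs' with (⟨r, hr, rfl⟩ | ⟨r, hr, rfl⟩) | hs'
      · exact (holds_tauDynamic h ⟨k + 1, hk⟩ k.succ_pos r).2 (hs _ hr ⟨k + 1, hk⟩ k.succ_pos)
      · exact hfinal r hr
      · cases hs'
        exact fun _ => ⟨_, List.mem_singleton_self _,
          (Trace.q_mem_encode (T := H) (k + 1)).2 ⟨by omega, hk⟩⟩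

/-- Models of the reduct below the code of a trace are codes of traces, as they contain the
facts `q`. -/
theorem exists_eq_encode (P : TemporalProgram α) (hP : P.IsPresentCentered)
    {Y Z : Set (StampedAtom α)} (hY : Y ⊆ T.encode)
    (hs : ∀ r ∈ (ProgramModule.bigJoin (pointwiseModule P hP) n).program,
      r.Holds (Literal.Holds Y Z)) : ∃ H : Trace α n, Y = H.encode := by
  refine ⟨fun i => {a | .atom a (i : ℕ) ∈ Y}, Set.Subset.antisymm ?_ ?_⟩
  · intro x hx
    -- Lying below a code excludes alphabet atoms stamped `n` or later and any `q` outside `1, …, n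
    -- - 1`.
    rcases hY hx with ⟨i, a, -, rfl⟩ | hq
    · exact Or.inl ⟨i, a, hx, rfl⟩
    · exact Or.inr hq
  · rintro x (⟨i, a, ha, rfl⟩ | ⟨i, h1, hi, rfl⟩)
    · exact ha
    · obtain ⟨j, rfl⟩ := Nat.exists_eq_add_of_le' h1
      obtain ⟨l, hl, h⟩ := hs ⟨[], [.pos (.q (j + 1))]⟩
        ((ProgramModule.mem_bigJoin_program _ _ _).2 ⟨j + 1, hi, Or.inr rfl⟩)
        (fun b hb => absurd hb List.not_mem_nil)
      obtain rfl := List.mem_singleton.1 hl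
      exact h

theorem isStableModel_encode_iff [NeZero n] (P : TemporalProgram α)
    (hP : P.IsPresentCentered) (T : Trace α n) :
    (ProgramModule.bigJoin (pointwiseModule P hP) n).IsStableModel T.encode ↔
      IsTemporalStableModel P.theory T := by
  rw [isTemporalStableModel_theory_iff hP, ProgramModule.IsStableModel, IsStableModel]
  simp only [satisfiesPositive_reduct_iff]
  refine and_congr (forall_mem_program_holds_iff P hP le_rfl) ⟨fun h H hH hs => ?_, ?_⟩
  · exact h _ (Trace.encode_ssubset_encode.2 hH) ((forall_mem_program_holds_iff P hP hH.le).2 hs)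
  · intro h Y hY hs
    obtain ⟨H, rfl⟩ := exists_eq_encode P hP hY.subset hs
    have hH := Trace.encode_ssubset_encode.1 hY
    exact h H hH ((forall_mem_program_holds_iff P hP hH.le).1 hs)

end Encode

end TEL

theorem mainTheorem7 {α : Type*} (P : TEL.TemporalProgram α) (hP : P.IsPresentCentered)
    (n : ℕ) [NeZero n] (T : TEL.Trace α n) (X : Set (TEL.StampedAtom α))
    (hX : X ⊆ ⋃ i : Fin n, TEL.alphabetAt α i)
    (hTX : ∀ (i : Fin n) (a : α), a ∈ T i ↔ TEL.StampedAtom.atom a i ∈ X) :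
    (∀ k : ℕ, k < n →
      (TEL.ProgramModule.bigJoin (TEL.pointwiseModule P hP) k).Compositional
        (TEL.pointwiseModule P hP k)) ∧
    (TEL.IsTemporalStableModel P.theory T ↔
      (TEL.ProgramModule.bigJoin (TEL.pointwiseModule P hP) n).IsStableModel
        (X ∪ {x | ∃ i : ℕ, 1 ≤ i ∧ i < n ∧ x = TEL.StampedAtom.q i})) := by
  refine ⟨fun k _ => TEL.compositional_bigJoin_pointwiseModule P hP k, ?_⟩
  rw [← TEL.isStableModel_encode_iff P hP T]
  -- By `hX`, the set `X` has no `q` and no stamp beyond the trace, so adding the `q i` gives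
  -- exactly `T.encode`.
  have hXT : X = {x | ∃ (i : Fin n) (a : α), a ∈ T i ∧ x = TEL.StampedAtom.atom a i} := by
    ext x
    constructor
    · intro hx
      obtain ⟨i, a, rfl⟩ := Set.mem_iUnion.1 (hX hx)
      exact ⟨i, a, (hTX i a).2 hx, rfl⟩
    · rintro ⟨i, a, ha, rfl⟩
      exact (hTX i a).1 ha
  rw [hXT, TEL.Trace.encode]
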